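/- Let $\Lambda=\bigoplus_{i\ge 0}\Lambda_i$ be an $\mathbb{N}$-graded ring with $\Lambda_0$ semisimple, and let $\operatorname{Gr-}\Lambda$ be the category of $\mathbb{Z}$-graded right $\Lambda$-modules with degree-preserving homomorphisms; $M(1)$ denotes the shift $M(1)_n=M_{n+1}$. A graded module $M$ is *Koszul* if it is generated in degree $0$ and it has a minimal graded projective resolution $\cdots\to P_1\to P_0\to M\to 0$ with $P_i$ generated in degree $i$ for all $i\ge 0$. Let $\mathcal{K}(\Lambda)$ be the full subcategory of Koszul modules. A *syzygy* $\Omega M$ of $M$ is given by an exact sequence $0\to\Omega M\to P_M\xrightarrow{\pi_M} M\to 0$ in $\operatorname{Gr-}\Lambda$ with $\pi_M$ a projective cover. **Proposition.** Every $M\in\mathcal{K}(\Lambda)$ has a syzygy. Fix a choice of syzygies $0\to\Omega M\to P_M\to M\to 0$ for all $M\in\mathcal{K}(\Lambda)$. Then: 1. There is exactly one functor $F\colon\mathcal{K}(\Lambda)\to\mathcal{K}(\Lambda)$ with $F(M)=\Omega M(1)$ on objects and such that, for each morphism $f\colon M\to N$ in $\mathcal{K}(\Lambda)$ and each $\widehat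 f\colon P_M\to P_N$ with $\pi_N\widehat f=f\pi_M$, the morphism $F(f)$ is the shift by $1$ of the restriction $\Omega M\to\Omega N$ of $\widehat f$. (In particular $\Omega M(1)$ is Koszul whenever $M$ is.) The functor $F$ is additive. 2. Let $M\in\mathcal{K}(\Lambda)$ be a finitely generated semisimple module. Then there is an isomorphism of graded rings $$O(F,M):=\bigoplus_{i\ge 0}\operatorname{Hom}_{\mathcal{K}(\Lambda)}(F^iM,M)\;\cong\;\operatorname{Ext}^\bullet_\Lambda(M,M)=\bigoplus_{i\ge 0}\operatorname{Ext}^i_\Lambda(M,M),$$ where the product in the orbital ring $O(F,M)$ of $f\colon F^iM\to M$ and $g\colon F^jM\to M$ is $f*g=f\circ F^i(g)$, the groups $\operatorname{Ext}^i_\Lambda$ are those of the category of (ungraded) right $\Lambda$-modules, and $\operatorname{Ext}^\bullet_\Lambda(M,M)$ carries the Yoneda product $\alpha\cdot\beta=$ "first $\beta$, then $\alpha$", which is composition $\alpha\circ\beta$ in degree $0$. -/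

import Mathlib

open CategoryTheory DirectSum

universe w v u

noncomputable section

/-! ### Orbital rings -/

/-- The `n`-th power `Fⁿ` of an endofunctor `F`, so that `F⁰ = 𝟭` and `Fⁿ⁺¹ X = Fⁿ (F X)`. -/
def iterFunctor {C : Type u} [Category.{v} C] (F : C ⥤ C) : ℕ → (C ⥤ C)
  | 0 => 𝟭 C
  | n + 1 => F ⋙ iterFunctor F n

theorem iterFunctor_add {C : Type u} [Category.{v} C] (F : C ⥤ C) (i j : ℕ) :
    iterFunctor F (i + j) = iterFunctor F j ⋙ iterFunctor F i := by
  induction j with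
  | zero => rfl
  | succ j ih =>
    change F ⋙ iterFunctor F (i + j) = (F ⋙ iterFunctor F j) ⋙ iterFunctor F i
    rw [ih]; rfl

instance iterFunctor_additive {C : Type u} [Category.{v} C] [Preadditive C] (F : C ⥤ C)
    [F.Additive] (n : ℕ) : (iterFunctor F n).Additive := by
  induction n with
  | zero => exact inferInstanceAs (𝟭 C).Additive
  | succ n ih => exact inferInstanceAs (F ⋙ iterFunctor F n).Additive

/-- The degree `i` component `Hom(Fⁱ M, M)` of the orbital ring. -/
def OrbitalPiece {C : Type u} [Category.{v} C] (F : C ⥤ C) (M : C) (i : ℕ) : Type v :=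
  (iterFunctor F i).obj M ⟶ M

instance {C : Type u} [Category.{v} C] [Preadditive C] (F : C ⥤ C) (M : C) (i : ℕ) :
    AddCommGroup (OrbitalPiece F M i) :=
  inferInstanceAs (AddCommGroup ((iterFunctor F i).obj M ⟶ M))

/-- The product `f * g = f ∘ Fⁱ(g)` of `f : Fⁱ M ⟶ M` and `g : Fʲ M ⟶ M`, where `Fⁱ⁺ʲ M` is
identified with `Fⁱ (Fʲ M)`. -/
def orbitalMul {C : Type u} [Category.{v} C] (F : C ⥤ C) (M : C) {i j : ℕ}
    (f : OrbitalPiece F M i) (g : OrbitalPiece F M j) : OrbitalPiece F M (i + j) :=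
  eqToHom (congrArg (fun G : C ⥤ C => G.obj M) (iterFunctor_add F i j)) ≫
    (iterFunctor F i).map g ≫ f

theorem orbitalPiece_mk_eq {C : Type u} [Category.{v} C] (F : C ⥤ C) (M : C) {i j : ℕ}
    (h : i = j) (a : (iterFunctor F i).obj M ⟶ M) (b : (iterFunctor F j).obj M ⟶ M)
    (hab : a = eqToHom (by rw [h]) ≫ b) :
    (⟨i, a⟩ : GradedMonoid (OrbitalPiece F M)) = ⟨j, b⟩ := by
  subst h
  rw [hab, eqToHom_refl, Category.id_comp]

theorem orbitalMul_assoc_aux {C : Type u} [Category.{v} C] (F : C ⥤ C) (M : C) {i j k : ℕ}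
    (f : (iterFunctor F i).obj M ⟶ M) (g : (iterFunctor F j).obj M ⟶ M)
    (h : (iterFunctor F k).obj M ⟶ M) :
    (orbitalMul F M (orbitalMul F M f g : OrbitalPiece F M (i + j)) h :
        (iterFunctor F (i + j + k)).obj M ⟶ M) =
      eqToHom (by rw [add_assoc]) ≫
        (orbitalMul F M f (orbitalMul F M g h : OrbitalPiece F M (j + k)) :
          (iterFunctor F (i + (j + k))).obj M ⟶ M) := by
  unfold orbitalMul
  dsimp only [OrbitalPiece]
  rw [Functor.congr_hom (iterFunctor_add F i j) h]
  simp [eqToHom_map]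

instance {C : Type u} [Category.{v} C] (F : C ⥤ C) (M : C) :
    GradedMonoid.GOne (OrbitalPiece F M) := ⟨𝟙 M⟩

instance {C : Type u} [Category.{v} C] (F : C ⥤ C) (M : C) :
    GradedMonoid.GMul (OrbitalPiece F M) := ⟨fun f g => orbitalMul F M f g⟩

/-- The graded ring structure of the orbital ring `O(F, M) = ⨁ᵢ Hom(Fⁱ M, M)`: `1 = 𝟙 M` in
degree `0`, product `orbitalMul`. -/
instance orbitalGRing {C : Type u} [Category.{v} C] [Preadditive C] (F : C ⥤ C) [F.Additive]
    (M : C) : GRing (OrbitalPiece F M) where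
  one_mul := by
    rintro ⟨j, g⟩
    refine orbitalPiece_mk_eq F M (zero_add j) _ _ ?_
    exact congrArg (fun t => eqToHom _ ≫ t) (Category.comp_id g)
  mul_one := by
    rintro ⟨i, f⟩
    refine orbitalPiece_mk_eq F M (add_zero i) _ _ ?_
    refine congrArg (fun t => eqToHom _ ≫ t) ?_
    exact (congrArg (fun t => t ≫ f) ((iterFunctor F i).map_id M)).trans (Category.id_comp f)
  mul_assoc := by
    rintro ⟨i, f⟩ ⟨j, g⟩ ⟨k, h⟩
    exact orbitalPiece_mk_eq F M (add_assoc i j k) _ _ (orbitalMul_assoc_aux F M f g h)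
  mul_zero {i j} f := by
    have h : (iterFunctor F i).map (0 : (iterFunctor F j).obj M ⟶ M) = 0 :=
      Functor.map_zero _ _ _
    refine (congrArg (fun t => eqToHom _ ≫ t ≫ f) h).trans ?_
    exact (congrArg (fun t => eqToHom _ ≫ t) Limits.zero_comp).trans Limits.comp_zero
  zero_mul {i j} g := by
    change eqToHom _ ≫ (iterFunctor F i).map g ≫ (0 : (iterFunctor F i).obj M ⟶ M) =
      (0 : (iterFunctor F (i + j)).obj M ⟶ M)
    rw [Limits.comp_zero, Limits.comp_zero]
  mul_add {i j} f g g' := by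
    have h := (iterFunctor F i).map_add (f := (g : (iterFunctor F j).obj M ⟶ M)) (g := g')
    refine (congrArg (fun t => eqToHom _ ≫ t ≫ f) h).trans ?_
    exact (congrArg (fun t => eqToHom _ ≫ t) (Preadditive.add_comp _ _ _ _ _ f)).trans
      (Preadditive.comp_add _ _ _ _ _ _)
  add_mul {i j} f f' g :=
    (congrArg (fun t => eqToHom _ ≫ t)
      (Preadditive.comp_add _ _ _ ((iterFunctor F i).map g) f f')).trans
      (Preadditive.comp_add _ _ _ _ _ _)
  natCast n := n • (GradedMonoid.GOne.one : OrbitalPiece F M 0)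
  natCast_zero := zero_smul _ _
  natCast_succ n := succ_nsmul _ n
  intCast n := n • (GradedMonoid.GOne.one : OrbitalPiece F M 0)
  intCast_ofNat n := natCast_zsmul _ n
  intCast_negSucc_ofNat n := negSucc_zsmul _ n

/-! ### Yoneda algebras -/

/-- The degree `i` component `Extⁱ(M, M)` of the Yoneda algebra. -/
def YonedaPiece {C : Type u} [Category.{v} C] [Abelian C] [HasExt.{w} C] (M : C) (i : ℕ) :
    Type w :=
  Abelian.Ext.{w} M M i

instance {C : Type u} [Category.{v} C] [Abelian C] [HasExt.{w} C] (M : C) (i : ℕ) :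
    AddCommGroup (YonedaPiece M i) :=
  inferInstanceAs (AddCommGroup (Abelian.Ext.{w} M M i))

theorem yonedaPiece_mk_eq {C : Type u} [Category.{v} C] [Abelian C] [HasExt.{w} C] (M : C)
    {a b i j : ℕ} (α : Abelian.Ext.{w} M M a) (β : Abelian.Ext.{w} M M b)
    (hi : a + b = i) (hj : a + b = j) :
    (⟨i, α.comp β hi⟩ : GradedMonoid (YonedaPiece M)) = ⟨j, α.comp β hj⟩ := by
  subst hi; subst hj; rfl

instance {C : Type u} [Category.{v} C] [Abelian C] [HasExt.{w} C] (M : C) :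
    GradedMonoid.GOne (YonedaPiece.{w} M) := ⟨Abelian.Ext.mk₀ (𝟙 M)⟩

/-- The Yoneda product `α * β` is the composite "`β` first, then `α`"; in degree `0` it is the
composition `α ∘ β` of endomorphisms. -/
instance {C : Type u} [Category.{v} C] [Abelian C] [HasExt.{w} C] (M : C) :
    GradedMonoid.GMul (YonedaPiece.{w} M) :=
  ⟨fun {i j} α β => Abelian.Ext.comp β α (add_comm j i)⟩

/-- The graded ring structure of the Yoneda algebra `Ext^•(M, M) = ⨁ᵢ Extⁱ(M, M)`. -/
instance yonedaGRing {C : Type u} [Category.{v} C] [Abelian C] [HasExt.{w} C] (M : C) :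
    GRing (YonedaPiece.{w} M) where
  one_mul := by
    rintro ⟨j, β⟩
    refine (yonedaPiece_mk_eq M β (Abelian.Ext.mk₀ (𝟙 M)) _ (add_zero j)).trans ?_
    exact congrArg (Sigma.mk j) (Abelian.Ext.comp_mk₀_id β)
  mul_one := by
    rintro ⟨j, β⟩
    refine (yonedaPiece_mk_eq M (Abelian.Ext.mk₀ (𝟙 M)) β _ (zero_add j)).trans ?_
    exact congrArg (Sigma.mk j) (Abelian.Ext.mk₀_id_comp β)
  mul_assoc := by
    rintro ⟨i, α⟩ ⟨j, β⟩ ⟨k, γ⟩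
    refine (yonedaPiece_mk_eq M γ (Abelian.Ext.comp β α (add_comm j i)) _
      (show k + (i + j) = i + (j + k) by omega)).trans ?_
    exact congrArg (Sigma.mk (i + (j + k)))
      (Abelian.Ext.comp_assoc γ β α (add_comm k j) (add_comm j i) (by omega)).symm
  mul_zero {i j} α := Abelian.Ext.zero_comp M j α _ _
  zero_mul {i j} β := Abelian.Ext.comp_zero β M i _ _
  mul_add α β β' := Abelian.Ext.add_comp β β' α _
  add_mul α α' β := Abelian.Ext.comp_add β α α' _
  natCast n := n • (GradedMonoid.GOne.one : YonedaPiece.{w} M 0)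
  natCast_zero := zero_smul _ _
  natCast_succ n := succ_nsmul _ n
  intCast n := n • (GradedMonoid.GOne.one : YonedaPiece.{w} M 0)
  intCast_ofNat n := natCast_zsmul _ n
  intCast_negSucc_ofNat n := negSucc_zsmul _ n

/-- The `ℕ`-graded rings `⨁ᵢ A i` and `⨁ᵢ B i` are isomorphic as graded rings: there is a ring
isomorphism that sends
homogeneous elements of degree `i` to homogeneous elements of degree `i`. -/
def GradedRingIsomorphic (A : ℕ → Type v) (B : ℕ → Type w) [∀ i, AddCommGroup (A i)]
    [∀ i, AddCommGroup (B i)] [GRing A] [GRing B] : Prop :=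
  ∃ e : (⨁ i, A i) ≃+* (⨁ i, B i), ∀ (i : ℕ) (a : A i), ∃ b : B i, e (of A i a) = of B i b

/-! ### Graded right modules -/

/-- A `ℤ`-graded right module over a ring `Λ` graded by `𝒜 : ℕ → AddSubgroup Λ`.  Right
`Λ`-modules are modules over `Λᵐᵒᵖ`. -/
structure GrMod {Λ : Type u} [Ring Λ] (𝒜 : ℕ → AddSubgroup Λ) where
  carrier : Type u
  [addCommGroup : AddCommGroup carrier]
  [module : Module Λᵐᵒᵖ carrier]
  /-- the homogeneous components -/
  piece : ℤ → AddSubgroup carrier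
  isInternal : DirectSum.IsInternal piece
  smul_mem : ∀ (i : ℕ) (n : ℤ) (a : Λ) (m : carrier),
    a ∈ 𝒜 i → m ∈ piece n → MulOpposite.op a • m ∈ piece (n + i)

namespace GrMod

attribute [instance] GrMod.addCommGroup GrMod.module

variable {Λ : Type u} [Ring Λ] {𝒜 : ℕ → AddSubgroup Λ}

/-- Degree-preserving module homomorphisms. -/
@[ext]
structure Hom (M N : GrMod 𝒜) where
  toLin : M.carrier →ₗ[Λᵐᵒᵖ] N.carrier
  map_mem : ∀ (n : ℤ) (m : M.carrier), m ∈ M.piece n → toLin m ∈ N.piece n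

/-- The category `Gr-Λ` of `ℤ`-graded right `Λ`-modules. -/
instance : Category.{u} (GrMod 𝒜) where
  Hom := Hom
  id M := ⟨LinearMap.id, fun _ _ h => h⟩
  comp f g := ⟨g.toLin ∘ₗ f.toLin, fun n m h => g.map_mem n _ (f.map_mem n m h)⟩

/-- The underlying `Λ`-linear map of a morphism of graded modules. -/
def lin {M N : GrMod 𝒜} (f : M ⟶ N) : M.carrier →ₗ[Λᵐᵒᵖ] N.carrier := Hom.toLin f

theorem lin_injective {M N : GrMod 𝒜} : Function.Injective (lin : (M ⟶ N) → _) :=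
  fun _ _ h => Hom.ext h

theorem lin_mem {M N : GrMod 𝒜} (f : M ⟶ N) (n : ℤ) (m : M.carrier) (h : m ∈ M.piece n) :
    lin f m ∈ N.piece n := Hom.map_mem f n m h

@[simp] theorem lin_id (M : GrMod 𝒜) : lin (𝟙 M) = LinearMap.id := rfl

@[simp] theorem lin_comp {M N P : GrMod 𝒜} (f : M ⟶ N) (g : N ⟶ P) :
    lin (f ≫ g) = lin g ∘ₗ lin f := rfl

instance (M N : GrMod 𝒜) : Zero (M ⟶ N) := ⟨⟨0, fun n _ _ => (N.piece n).zero_mem⟩⟩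
instance (M N : GrMod 𝒜) : Add (M ⟶ N) :=
  ⟨fun f g => ⟨lin f + lin g, fun n m h => (N.piece n).add_mem (lin_mem f n m h) (lin_mem g n m h)⟩⟩
instance (M N : GrMod 𝒜) : Neg (M ⟶ N) :=
  ⟨fun f => ⟨-lin f, fun n m h => (N.piece n).neg_mem (lin_mem f n m h)⟩⟩
instance (M N : GrMod 𝒜) : Sub (M ⟶ N) :=
  ⟨fun f g => ⟨lin f - lin g, fun n m h => (N.piece n).sub_mem (lin_mem f n m h) (lin_mem g n m h)⟩⟩
instance (M N : GrMod 𝒜) : SMul ℕ (M ⟶ N) :=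
  ⟨fun k f => ⟨k • lin f, fun n m h => (N.piece n).nsmul_mem (lin_mem f n m h) k⟩⟩
instance (M N : GrMod 𝒜) : SMul ℤ (M ⟶ N) :=
  ⟨fun k f => ⟨k • lin f, fun n m h => (N.piece n).zsmul_mem (lin_mem f n m h) k⟩⟩

instance (M N : GrMod 𝒜) : AddCommGroup (M ⟶ N) :=
  Function.Injective.addCommGroup (lin : (M ⟶ N) → _) lin_injective rfl (fun _ _ => rfl)
    (fun _ => rfl) (fun _ _ => rfl) (fun _ _ => rfl) (fun _ _ => rfl)

/-- Morphisms of graded modules are added pointwise. -/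
instance : Preadditive (GrMod 𝒜) where
  add_comp M N P f f' g := by
    refine lin_injective (LinearMap.ext fun m => ?_)
    exact (lin g).map_add (lin f m) (lin f' m)
  comp_add _ _ _ _ _ _ := rfl

/-- The shift `M(k)`, with `M(k)ₙ = M_{k+n}`. -/
def shift (k : ℤ) (M : GrMod 𝒜) : GrMod 𝒜 where
  carrier := M.carrier
  piece n := M.piece (k + n)
  isInternal := by
    let e : (⨁ n, M.piece n) ≃+ ⨁ n, M.piece (k + n) :=
      DirectSum.equivCongrLeft (Equiv.addLeft k).symm
    have h : (DirectSum.coeAddMonoidHom fun n => M.piece (k + n)).comp e.toAddMonoidHom =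
        DirectSum.coeAddMonoidHom M.piece := by
      refine DirectSum.addHom_ext fun n y => ?_
      obtain ⟨n, rfl⟩ := (Equiv.addLeft k).surjective n
      have := DirectSum.equivCongrLeft_of (β := fun n => M.piece n) (Equiv.addLeft k).symm n y
      simp only [AddMonoidHom.comp_apply, DirectSum.coeAddMonoidHom_of]
      refine (congrArg _ this).trans ?_
      exact DirectSum.coeAddMonoidHom_of (fun n => M.piece (k + n)) n y
    have h' : DirectSum.coeAddMonoidHom (fun n => M.piece (k + n)) =
        (DirectSum.coeAddMonoidHom M.piece).comp e.symm.toAddMonoidHom := by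
      rw [← h]; ext x; simp
    unfold DirectSum.IsInternal
    rw [h']
    exact M.isInternal.comp e.symm.bijective
  smul_mem i n a m ha hm := by
    rw [← add_assoc]
    exact M.smul_mem i (k + n) a m ha hm

/-- The shift functor `M ↦ M(k)`, which does not change the underlying maps. -/
def shiftFunctor (k : ℤ) : GrMod 𝒜 ⥤ GrMod 𝒜 where
  obj M := shift k M
  map {M N} f :=
    let φ : M.carrier →ₗ[Λᵐᵒᵖ] N.carrier := lin f
    show Hom (shift k M) (shift k N) from ⟨φ, fun n m h => lin_mem f (k + n) m h⟩

/-- `M` is generated in degree `n`, i.e. `M = Mₙ Λ`. -/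
def GeneratedInDegree (M : GrMod 𝒜) (n : ℤ) : Prop :=
  Submodule.span Λᵐᵒᵖ (M.piece n : Set M.carrier) = ⊤

/-- The kernel of `f : P ⟶ M` is superfluous: if the graded submodule `N = im g` satisfies
`N + ker f = P`, then `N = P`. -/
def SuperfluousKernel {P M : GrMod 𝒜} (f : P ⟶ M) : Prop :=
  ∀ (X : GrMod 𝒜) (g : X ⟶ P),
    LinearMap.range (lin g) ⊔ LinearMap.ker (lin f) = ⊤ → LinearMap.range (lin g) = ⊤

/-- `f : P ⟶ M` is a projective cover in the category of graded modules. -/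
structure IsProjectiveCover {P M : GrMod 𝒜} (f : P ⟶ M) : Prop where
  projective : Projective P
  surjective : Function.Surjective (lin f)
  superfluous : SuperfluousKernel f

/-- A minimal graded projective resolution `⋯ → P₂ → P₁ → P₀ → M → 0`: an exact complex of graded
projective modules in which each term is a projective cover of the image of its differential,
that is, each map has superfluous kernel. -/
structure MinimalResolution (M : GrMod 𝒜) where
  P : ℕ → GrMod 𝒜
  d : ∀ i, P (i + 1) ⟶ P i
  ε : P 0 ⟶ M
  projective : ∀ i, Projective (P i)
  surjective : Function.Surjective (lin ε)
  exact_zero : Function.Exact (lin (d 0)) (lin ε)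
  exact_succ : ∀ i, Function.Exact (lin (d (i + 1))) (lin (d i))
  minimal_zero : SuperfluousKernel ε
  minimal_succ : ∀ i, SuperfluousKernel (d i)

/-- Koszul modules: generated in degree `0`, with a minimal graded projective resolution whose
`i`-th term is generated in degree `i` for all `i`. -/
def isKoszul (𝒜 : ℕ → AddSubgroup Λ) : ObjectProperty (GrMod 𝒜) := fun M =>
  M.GeneratedInDegree 0 ∧ ∃ R : MinimalResolution M, ∀ i : ℕ, (R.P i).GeneratedInDegree i

/-- A syzygy `Ω` of `M`: a short exact sequence `0 → Ω → P → M → 0` of graded modules in which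
`P → M` is a projective cover. -/
structure Syzygy (M : GrMod 𝒜) where
  Ω : GrMod 𝒜
  P : GrMod 𝒜
  ι : Ω ⟶ P
  π : P ⟶ M
  cover : IsProjectiveCover π
  injective : Function.Injective (lin ι)
  exact : Function.Exact (lin ι) (lin π)

end GrMod

open GrMod

/-- The category `𝒦(Λ)` of Koszul right modules, a full subcategory of `Gr-Λ`. -/
abbrev KoszulMod {Λ : Type u} [Ring Λ] (𝒜 : ℕ → AddSubgroup Λ) := (isKoszul 𝒜).FullSubcategory

/-- `F` is the endofunctor `Ω(-)(1)` of `𝒦(Λ)` attached to the choice `Z` of syzygies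
`0 → Ω M → P_M → M → 0`.  On objects `F M = (Ω M)(1)`.  For `f : M ⟶ N` and every lift
`f' : P_M ⟶ P_N` of `f`, the square
`(Ω M)(1) → P_M(1)`, `(Ω N)(1) → P_N(1)` with vertical maps `F f` and `f'(1)` commutes, that is,
`F f` is the shift by `1` of the restriction `Ω f : Ω M → Ω N` of `f'`. -/
def IsShiftedSyzygyFunctor {Λ : Type u} [Ring Λ] {𝒜 : ℕ → AddSubgroup Λ}
    (Z : ∀ M : KoszulMod 𝒜, Syzygy M.obj) (F : KoszulMod 𝒜 ⥤ KoszulMod 𝒜) : Prop :=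
  ∃ h : ∀ M : KoszulMod 𝒜, (F.obj M).obj = (shiftFunctor 1).obj (Z M).Ω,
    ∀ (M N : KoszulMod 𝒜) (f : M ⟶ N) (f' : (Z M).P ⟶ (Z N).P),
      f' ≫ (Z N).π = (Z M).π ≫ f.hom →
        (F.map f).hom ≫ eqToHom (h N) ≫ (shiftFunctor 1).map (Z N).ι =
          eqToHom (h M) ≫ (shiftFunctor 1).map (Z M).ι ≫ (shiftFunctor 1).map f'

end

noncomputable section

/-! Degrees do all the work. The augmentation of a minimal resolution is a projective cover, and
projective covers are unique up to isomorphism. So for Koszul `M` and any choice of syzygy, `P_M` is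
generated in degree 0, while `Ω M`, a quotient of the term `P 1` of the resolution, is generated in
degree 1. The tail of the resolution, shifted by 1, resolves `Ω M(1)`, which is therefore Koszul.
Two lifts `P_M ⟶ P_N` of one morphism differ on generators by elements of `(Ω N)₀ = 0`, so lifts are
unique (`Syzygy.lift_unique`). Existence and functoriality of `F` follow; uniqueness and additivity
follow because `Ω N ⟶ P_N` is mono.

For the ring isomorphism, a semisimple `M` generated in degree 0 is killed by positive degrees of
`Λ` and lives in degree 0. Hence ungraded maps from a Koszul `X` to `M` are automatically graded,
and ungraded maps `P_X → M` vanish on `Ω X`. Graded projectives stay projective without the grading,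
so in the long exact `Ext` sequence of `0 → F X → P_X → X → 0` composition with the extension class
`δ X` is bijective `Extⁿ(F X, M) → Extⁿ⁺¹(X, M)`, also for `n = 0`
(`syzygySequence_extClass_comp_bijective`). Splicing these classes gives `Hom(Fⁿ M, M) ≅ Extⁿ(M,
M)`, and naturality of `δ` turns `f ∘ Fⁱ(g)` into the Yoneda product (`orbitalToExt_comp`). -/

/-- A family of subgroups that generates the group and admits projections is an internal direct
sum. -/
theorem isInternal_of_projections {ι M : Type*} [DecidableEq ι] [AddCommGroup M]
    (A : ι → AddSubgroup M) (p : ι → M →+ M) (hp : ∀ n, ∀ m ∈ A n, p n m = m)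
    (hp' : ∀ n k, k ≠ n → ∀ m ∈ A k, p n m = 0) (hA : ∀ m, m ∈ ⨆ n, A n) :
    DirectSum.IsInternal A := by
  -- The projections read off the coefficients of a sum, which gives injectivity.
  have key : ∀ (x : ⨁ n, A n) (n : ι), p n (DirectSum.coeAddMonoidHom A x) = x n := by
    intro x n
    induction x using DirectSum.induction_on with
    | zero => simp
    | of k y =>
      rw [DirectSum.coeAddMonoidHom_of]
      by_cases h : k = n
      · subst h; rw [hp _ _ y.2, DirectSum.of_eq_same]
      · rw [hp' n k h _ y.2, DirectSum.of_eq_of_ne _ _ _ (Ne.symm h)]; rfl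
    | add x y hx hy => simp [hx, hy]
  refine ⟨(injective_iff_map_eq_zero _).2 fun x hx => DirectSum.ext fun n => Subtype.ext ?_,
    fun m => ?_⟩
  · rw [← key, hx]; simp
  · have h : ⨆ n, A n ≤ (DirectSum.coeAddMonoidHom A).range := iSup_le fun n m hm =>
      ⟨of (fun n => A n) n ⟨m, hm⟩, DirectSum.coeAddMonoidHom_of A n ⟨m, hm⟩⟩
    exact h (hA m)

namespace GrMod

variable {Λ : Type u} [Ring Λ] {𝒜 : ℕ → AddSubgroup Λ}

/-! ### Homogeneous components -/

/-- The projection of a graded module onto its component of degree `n`. -/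
def proj (M : GrMod 𝒜) (n : ℤ) : M.carrier →+ M.carrier :=
  letI := M.isInternal.chooseDecomposition
  { toFun := fun m => DirectSum.decompose M.piece m n
    map_zero' := by simp
    map_add' := by simp }

theorem proj_mem (M : GrMod 𝒜) (n : ℤ) (m : M.carrier) : M.proj n m ∈ M.piece n :=
  letI := M.isInternal.chooseDecomposition
  (DirectSum.decompose M.piece m n).2

theorem proj_of_mem {M : GrMod 𝒜} {n : ℤ} {m : M.carrier} (h : m ∈ M.piece n) :
    M.proj n m = m :=
  letI := M.isInternal.chooseDecomposition
  DirectSum.decompose_of_mem_same M.piece h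

theorem proj_of_mem_ne {M : GrMod 𝒜} {n k : ℤ} {m : M.carrier} (h : m ∈ M.piece k) (hk : k ≠ n) :
    M.proj n m = 0 :=
  letI := M.isInternal.chooseDecomposition
  DirectSum.decompose_of_mem_ne M.piece h hk

theorem homogeneous_induction {M : GrMod 𝒜} {p : M.carrier → Prop} (zero : p 0)
    (add : ∀ x y, p x → p y → p (x + y)) (hom : ∀ n, ∀ x ∈ M.piece n, p x) (m : M.carrier) :
    p m :=
  letI := M.isInternal.chooseDecomposition
  DirectSum.Decomposition.inductionOn M.piece zero (fun {i} x => hom i x x.2) add m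

theorem exists_sum_proj (M : GrMod 𝒜) (m : M.carrier) :
    ∃ s : Finset ℤ, m = ∑ n ∈ s, M.proj n m := by
  classical
  let _ := M.isInternal.chooseDecomposition
  exact ⟨_, (DirectSum.sum_support_decompose M.piece m).symm⟩

theorem proj_lin {M N : GrMod 𝒜} (f : M ⟶ N) (n : ℤ) (m : M.carrier) :
    N.proj n (lin f m) = lin f (M.proj n m) := by
  induction m using homogeneous_induction with
  | zero => simp
  | add x y hx hy => simp [hx, hy]
  | hom k x hx =>
    by_cases h : k = n
    · subst h; rw [proj_of_mem hx, proj_of_mem (lin_mem f _ _ hx)]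
    · rw [proj_of_mem_ne hx h, proj_of_mem_ne (lin_mem f _ _ hx) h, map_zero]

/-- Morphisms commute with projections, so an injective one reflects degrees. Factorizations and
inverses built linearly are thus automatically graded. -/
theorem mem_piece_of_lin_mem {M N : GrMod 𝒜} {f : M ⟶ N} (hf : Function.Injective (lin f)) {n : ℤ}
    {m : M.carrier} (h : lin f m ∈ N.piece n) : m ∈ M.piece n := by
  have : M.proj n m = m := hf (by rw [← proj_lin, proj_of_mem h])
  rw [← this]
  exact M.proj_mem n m

/-! ### Kernels -/

/-- The kernel of a morphism of graded modules. -/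
def ker {M N : GrMod 𝒜} (f : M ⟶ N) : GrMod 𝒜 where
  carrier := LinearMap.ker (lin f)
  piece n := (M.piece n).comap (LinearMap.ker (lin f)).subtype.toAddMonoidHom
  isInternal := by
    -- The projections commute with `f`, hence preserve its kernel.
    refine isInternal_of_projections _ (fun n =>
      ((M.proj n).comp (LinearMap.ker (lin f)).subtype.toAddMonoidHom).codRestrict
        (LinearMap.ker (lin f)).toAddSubgroup ?_) ?_ ?_ ?_
    · intro m
      change lin f (M.proj n m.1) = 0
      rw [← proj_lin, m.2, map_zero]
    · exact fun n m hm => Subtype.ext (proj_of_mem hm)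
    · exact fun n k hk m hm => Subtype.ext (proj_of_mem_ne hm hk)
    · intro m
      have hk : ∀ n, M.proj n m.1 ∈ LinearMap.ker (lin f) := fun n => by
        rw [LinearMap.mem_ker, ← proj_lin, m.2, map_zero]
      obtain ⟨s, hs⟩ := M.exists_sum_proj m.1
      have : m = ∑ n ∈ s, (⟨M.proj n m.1, hk n⟩ : LinearMap.ker (lin f)) :=
        Subtype.ext (by rw [Submodule.coe_sum]; exact hs)
      rw [this]
      exact sum_mem fun n _ => AddSubgroup.mem_iSup_of_mem n (M.proj_mem n m.1)
  smul_mem i n a m ha hm := M.smul_mem i n a m.1 ha hm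

/-- The inclusion of the kernel. -/
def kerι {M N : GrMod 𝒜} (f : M ⟶ N) : ker f ⟶ M :=
  show Hom (ker f) M from ⟨(LinearMap.ker (lin f)).subtype, fun _ _ h => h⟩

theorem kerι_injective {M N : GrMod 𝒜} (f : M ⟶ N) : Function.Injective (lin (kerι f)) :=
  Subtype.val_injective

theorem kerι_exact {M N : GrMod 𝒜} (f : M ⟶ N) : Function.Exact (lin (kerι f)) (lin f) :=
  fun m => ⟨fun h => ⟨⟨m, h⟩, rfl⟩, by rintro ⟨x, rfl⟩; exact x.2⟩

/-- Morphisms with image in the image of an injective morphism factor through it. -/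
theorem exists_lift {K P X : GrMod 𝒜} (ι : K ⟶ P) (hι : Function.Injective (lin ι)) (g : X ⟶ P)
    (hg : ∀ x, lin g x ∈ LinearMap.range (lin ι)) : ∃ g' : X ⟶ K, g' ≫ ι = g := by
  let e := LinearEquiv.ofInjective (lin ι) hι
  let φ : X.carrier →ₗ[Λᵐᵒᵖ] K.carrier := e.symm.toLinearMap ∘ₗ (lin g).codRestrict _ hg
  have h : ∀ x, lin ι (φ x) = lin g x := fun x =>
    congrArg Subtype.val (e.apply_symm_apply ((lin g).codRestrict _ hg x))
  refine ⟨(⟨φ, fun n m hm => mem_piece_of_lin_mem hι ?_⟩ : Hom X K), lin_injective ?_⟩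
  · rw [h]; exact lin_mem g n m hm
  · ext x; exact h x

theorem lin_comp_apply {M N P : GrMod 𝒜} (f : M ⟶ N) (g : N ⟶ P) (x : M.carrier) :
    lin (f ≫ g) x = lin g (lin f x) := rfl

theorem epi_of_surjective {M N : GrMod 𝒜} {f : M ⟶ N} (hf : Function.Surjective (lin f)) :
    Epi f where
  left_cancellation _ _ e := lin_injective <| LinearMap.ext fun y => by
    obtain ⟨x, rfl⟩ := hf y
    exact LinearMap.congr_fun (congrArg lin e) x

theorem mono_of_injective {M N : GrMod 𝒜} {f : M ⟶ N} (hf : Function.Injective (lin f)) :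
    Mono f where
  right_cancellation _ _ e := lin_injective <| LinearMap.ext fun y =>
    hf (LinearMap.congr_fun (congrArg lin e) y)

theorem isIso_of_bijective {M N : GrMod 𝒜} (f : M ⟶ N) (hf : Function.Bijective (lin f)) :
    ∃ e : M ≅ N, e.hom = f := by
  obtain ⟨g, hg⟩ := exists_lift f hf.1 (𝟙 N) fun x => hf.2 x
  have := mono_of_injective hf.1
  exact ⟨⟨f, g, by rw [← cancel_mono f, Category.assoc, hg]; simp, hg⟩, rfl⟩

theorem lin_iso_bijective {M N : GrMod 𝒜} (e : M ≅ N) : Function.Bijective (lin e.hom) :=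
  Function.bijective_iff_has_inverse.2 ⟨lin e.inv,
    fun x => LinearMap.congr_fun (congrArg lin e.hom_inv_id) x,
    fun x => LinearMap.congr_fun (congrArg lin e.inv_hom_id) x⟩

/-! ### Shifts -/

@[simp] theorem lin_shiftFunctor_map (k : ℤ) {M N : GrMod 𝒜} (f : M ⟶ N) (x : M.carrier) :
    lin ((shiftFunctor k).map f) x = lin f x := rfl

/-- Shifting back and forth. -/
def shiftShiftIso {k l : ℤ} (h : k + l = 0) (M : GrMod 𝒜) :
    (shiftFunctor l).obj ((shiftFunctor k).obj M) ≅ M where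
  hom := show Hom (shift l (shift k M)) M from ⟨(LinearMap.id : M.carrier →ₗ[Λᵐᵒᵖ] M.carrier),
    fun n m (hm : m ∈ M.piece (k + (l + n))) => by
      rwa [← add_assoc, h, zero_add] at hm⟩
  inv := show Hom M (shift l (shift k M)) from ⟨(LinearMap.id : M.carrier →ₗ[Λᵐᵒᵖ] M.carrier),
    fun n m hm => by
      change m ∈ M.piece (k + (l + n))
      rwa [← add_assoc, h, zero_add]⟩
  hom_inv_id := rfl
  inv_hom_id := rfl

/-- The shift is an equivalence of categories. -/
def shiftEquivalence (k : ℤ) : GrMod 𝒜 ≌ GrMod 𝒜 :=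
  CategoryTheory.Equivalence.mk (shiftFunctor k) (shiftFunctor (-k))
    (NatIso.ofComponents (fun M => (shiftShiftIso (add_neg_cancel k) M).symm) (fun _ => rfl))
    (NatIso.ofComponents (fun M => shiftShiftIso (neg_add_cancel k) M) (fun _ => rfl))

theorem projective_shift (k : ℤ) {P : GrMod 𝒜} (hP : Projective P) :
    Projective ((shiftFunctor k).obj P) :=
  ((shiftEquivalence (𝒜 := 𝒜) k).map_projective_iff P).2 hP

/-- A test morphism into the shift is shifted back; underlying maps, and so ranges and kernels, do
not change. -/
theorem superfluousKernel_shift (k : ℤ) {P M : GrMod 𝒜} {f : P ⟶ M} (hf : SuperfluousKernel f) :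
    SuperfluousKernel ((shiftFunctor k).map f) := fun _ g h =>
  hf _ ((shiftFunctor (-k)).map g ≫ (shiftShiftIso (add_neg_cancel k) P).hom) h

theorem superfluousKernel_of_ker_le {P M N : GrMod 𝒜} {f : P ⟶ M} {g : P ⟶ N}
    (hf : SuperfluousKernel f) (h : LinearMap.ker (lin g) ≤ LinearMap.ker (lin f)) :
    SuperfluousKernel g := fun _ φ hφ =>
  hf _ φ (top_le_iff.1 (hφ.ge.trans (sup_le_sup_left h _)))

theorem GeneratedInDegree.of_surjective {M N : GrMod 𝒜} {n : ℤ} (h : M.GeneratedInDegree n)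
    {f : M ⟶ N} (hf : Function.Surjective (lin f)) : N.GeneratedInDegree n := by
  unfold GeneratedInDegree at h ⊢
  rw [eq_top_iff, ← LinearMap.range_eq_top.2 hf, LinearMap.range_eq_map, ← h, Submodule.map_span]
  apply Submodule.span_mono
  rintro _ ⟨x, hx, rfl⟩
  exact lin_mem f n x hx

theorem GeneratedInDegree.shift {M : GrMod 𝒜} {k n : ℤ} (h : M.GeneratedInDegree (k + n)) :
    ((shiftFunctor k).obj M).GeneratedInDegree n := h

theorem GeneratedInDegree.hom_ext {M N : GrMod 𝒜} {n : ℤ} (h : M.GeneratedInDegree n)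
    {f g : M ⟶ N} (hfg : ∀ x ∈ M.piece n, lin f x = lin g x) : f = g :=
  lin_injective (LinearMap.ext_on h fun x hx => hfg x hx)

/-! ### Free graded modules -/

/-- The grading of a ring graded by `ℕ`, extended by zero to negative degrees. -/
def extendedPiece (𝒜 : ℕ → AddSubgroup Λ) : ℤ → AddSubgroup Λ
  | Int.ofNat n => 𝒜 n
  | Int.negSucc _ => ⊥

/-- The homogeneous components of the elements of a ring graded by `ℕ`, for all integer degrees. -/
def extendedProj (𝒜 : ℕ → AddSubgroup Λ) [GradedRing 𝒜] : ℤ → Λ →+ Λ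
  | Int.ofNat n => GradedRing.proj 𝒜 n
  | Int.negSucc _ => 0

theorem mul_mem_extendedPiece [GradedRing 𝒜] {n : ℤ} {i : ℕ} {x a : Λ}
    (hx : x ∈ extendedPiece 𝒜 n) (ha : a ∈ 𝒜 i) : x * a ∈ extendedPiece 𝒜 (n + i) := by
  rcases n with n | n
  · exact SetLike.mul_mem_graded (A := 𝒜) (show x ∈ 𝒜 n from hx) ha
  · rw [show x = 0 from hx, zero_mul]
    exact AddSubgroup.zero_mem _

theorem extendedProj_of_mem [GradedRing 𝒜] {n : ℤ} {x : Λ} (hx : x ∈ extendedPiece 𝒜 n) :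
    extendedProj 𝒜 n x = x := by
  rcases n with n | n
  · exact DirectSum.decompose_of_mem_same 𝒜 hx
  · exact (show x = 0 from hx).symm

theorem extendedProj_of_mem_ne [GradedRing 𝒜] {n k : ℤ} {x : Λ} (hx : x ∈ extendedPiece 𝒜 k)
    (h : k ≠ n) : extendedProj 𝒜 n x = 0 := by
  rcases n with n | n
  · rcases k with k | k
    · exact DirectSum.decompose_of_mem_ne 𝒜 hx (fun e => h (by rw [e]))
    · rw [show x = 0 from hx, map_zero]
  · rfl

/-- The free graded right module on generators `s : S` of degrees `deg s`. -/
def free (𝒜 : ℕ → AddSubgroup Λ) [GradedRing 𝒜] {S : Type u} (deg : S → ℤ) : GrMod 𝒜 where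
  carrier := S →₀ Λᵐᵒᵖ
  piece n :=
    { carrier := {f | ∀ s, (f s).unop ∈ extendedPiece 𝒜 (n - deg s)}
      zero_mem' := fun s => AddSubgroup.zero_mem _
      add_mem' := fun hf hg s => AddSubgroup.add_mem _ (hf s) (hg s)
      neg_mem' := fun hf s => AddSubgroup.neg_mem _ (hf s) }
  isInternal := by
    classical
    let q (n : ℤ) (s : S) : Λᵐᵒᵖ →+ Λᵐᵒᵖ :=
      MulOpposite.opAddEquiv.toAddMonoidHom.comp
        ((extendedProj 𝒜 (n - deg s)).comp MulOpposite.opAddEquiv.symm.toAddMonoidHom)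
    -- The projection to degree `n` takes the component of degree `n - deg s` in the coordinate `s`.
    let p (n : ℤ) : (S →₀ Λᵐᵒᵖ) →+ (S →₀ Λᵐᵒᵖ) :=
      Finsupp.liftAddHom fun s => (Finsupp.singleAddHom s).comp (q n s)
    have hp : ∀ n f s, p n f s = q n s (f s) := by
      intro n f s
      induction f using Finsupp.induction_linear with
      | zero => simp
      | add f g hf hg => simp [hf, hg]
      | single t a =>
        by_cases h : t = s
        · subst h; simp [p]
        · simp [p, h]
    refine isInternal_of_projections _ p ?_ ?_ ?_
    · intro n f hf
      ext s
      rw [hp]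
      exact congrArg MulOpposite.op (extendedProj_of_mem (hf s))
    · intro n k hk f hf
      ext s
      rw [hp]
      exact congrArg MulOpposite.op (extendedProj_of_mem_ne (hf s) fun h => hk (by omega))
    · intro f
      induction f using Finsupp.induction_linear with
      | zero => exact zero_mem _
      | add f g hf hg => exact add_mem hf hg
      | single t a =>
        induction a using MulOpposite.rec' with | h a => ?_
        induction a using DirectSum.Decomposition.inductionOn 𝒜 with
        | zero => simp [zero_mem]
        | add x y hx hy => rw [MulOpposite.op_add, Finsupp.single_add]; exact add_mem hx hy
        | homogeneous x =>
          rename_i i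
          refine AddSubgroup.mem_iSup_of_mem (deg t + i) fun s => ?_
          by_cases h : t = s
          · subst h
            rw [Finsupp.single_eq_same, add_sub_cancel_left]
            exact x.2
          · rw [Finsupp.single_apply, if_neg h]
            exact AddSubgroup.zero_mem _
  smul_mem i n a m ha hm s := by
    have := mul_mem_extendedPiece (hm s) ha
    rwa [sub_add_eq_add_sub] at this

theorem smul_mem_extended (M : GrMod 𝒜) {j n : ℤ} {a : Λ} {m : M.carrier}
    (ha : a ∈ extendedPiece 𝒜 j) (hm : m ∈ M.piece n) : MulOpposite.op a • m ∈ M.piece (n + j) := by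
  rcases j with j | j
  · exact M.smul_mem j n a m ha hm
  · rw [show a = 0 from ha, MulOpposite.op_zero, zero_smul]
    exact AddSubgroup.zero_mem _

/-- A graded projective module is projective as an ungraded module. -/
theorem module_projective [GradedRing 𝒜] (P : GrMod 𝒜) (hP : Projective P) :
    Module.Projective Λᵐᵒᵖ P.carrier := by
  -- All homogeneous elements serve as generators. The graded free module on them maps onto `P`; a
  -- graded splitting is also an ungraded one.
  let S := Σ n, P.piece n
  let φ : (S →₀ Λᵐᵒᵖ) →ₗ[Λᵐᵒᵖ] P.carrier :=
    Finsupp.linearCombination Λᵐᵒᵖ fun s : S => (s.2 : P.carrier)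
  let π : free 𝒜 (fun s : S => s.1) ⟶ P := show Hom (free 𝒜 (fun s : S => s.1)) P from
    ⟨φ, fun n f hf => by
      refine AddSubgroup.sum_mem _ fun s _ => ?_
      have := smul_mem_extended P (hf s) s.2.2
      rwa [add_sub_cancel] at this⟩
  have hπ : Function.Surjective (lin π) := by
    refine LinearMap.range_eq_top.1 (eq_top_iff.2 fun m _ => ?_)
    induction m using homogeneous_induction with
    | zero => exact zero_mem _
    | add x y hx hy => exact add_mem (hx trivial) (hy trivial)
    | hom n x hx =>
      exact ⟨Finsupp.single (⟨n, x, hx⟩ : S) 1,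
        (Finsupp.linearCombination_single _ _ _).trans (one_smul _ _)⟩
  have := epi_of_surjective hπ
  have h : lin π ∘ₗ lin (Projective.factorThru (𝟙 P) π) = LinearMap.id := by
    rw [← lin_comp, Projective.factorThru_comp, lin_id]
  exact Module.Projective.of_split (M := S →₀ Λᵐᵒᵖ) _ φ h

/-! ### Degrees -/

/-- An additive subgroup stable under homogeneous scalars is a submodule. -/
def submoduleOfHomogeneous [GradedRing 𝒜] {M : GrMod 𝒜} (S : AddSubgroup M.carrier)
    (h : ∀ (i : ℕ) (a : Λ) (x : M.carrier), a ∈ 𝒜 i → x ∈ S → MulOpposite.op a • x ∈ S) :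
    Submodule Λᵐᵒᵖ M.carrier :=
  { S with
    smul_mem' := fun a x hx => by
      induction a using MulOpposite.rec' with | h a => ?_
      induction a using DirectSum.Decomposition.inductionOn 𝒜 with
      | zero => rw [MulOpposite.op_zero, zero_smul]; exact S.zero_mem
      | add a b ha hb => rw [MulOpposite.op_add, add_smul]; exact S.add_mem ha hb
      | homogeneous a => exact h _ a x a.2 hx }

/-- An induction principle: additive conditions need checking only on generators and under
homogeneous scalars, since these span `Λ`. -/
theorem GeneratedInDegree.mem_of_homogeneous [GradedRing 𝒜] {M : GrMod 𝒜} {n : ℤ}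
    (hM : M.GeneratedInDegree n) (S : AddSubgroup M.carrier)
    (h : ∀ (i : ℕ) (a : Λ) (x : M.carrier), a ∈ 𝒜 i → x ∈ S → MulOpposite.op a • x ∈ S)
    (hn : M.piece n ≤ S) (m : M.carrier) : m ∈ S := by
  have : (⊤ : Submodule Λᵐᵒᵖ M.carrier) ≤ submoduleOfHomogeneous S h :=
    hM ▸ Submodule.span_le.2 hn
  exact this trivial

theorem proj_smul (M : GrMod 𝒜) {i : ℕ} {a : Λ} (ha : a ∈ 𝒜 i) (k : ℤ) (m : M.carrier) :
    M.proj k (MulOpposite.op a • m) = MulOpposite.op a • M.proj (k - i) m := by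
  induction m using homogeneous_induction with
  | zero => simp
  | add x y hx hy => simp [hx, hy]
  | hom n x hx =>
    have h := M.smul_mem i n a x ha hx
    by_cases hk : n + i = k
    · subst hk; rw [proj_of_mem h, add_sub_cancel_right, proj_of_mem hx]
    · rw [proj_of_mem_ne h hk, proj_of_mem_ne hx (by omega), smul_zero]

/-- The elements whose components of degree less than `n` vanish. -/
def truncation [GradedRing 𝒜] (M : GrMod 𝒜) (n : ℤ) : Submodule Λᵐᵒᵖ M.carrier :=
  submoduleOfHomogeneous (⨅ k : {k : ℤ // k < n}, (M.proj k).ker) fun i a x ha hx => by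
    simp only [AddSubgroup.mem_iInf, AddMonoidHom.mem_ker, Subtype.forall] at hx ⊢
    intro k hk
    rw [proj_smul M ha, hx _ (by omega), smul_zero]

theorem mem_truncation [GradedRing 𝒜] {M : GrMod 𝒜} {n : ℤ} {x : M.carrier} :
    x ∈ M.truncation n ↔ ∀ k < n, M.proj k x = 0 := by
  change x ∈ (⨅ k : {k : ℤ // k < n}, (M.proj k).ker) ↔ _
  simp only [AddSubgroup.mem_iInf, AddMonoidHom.mem_ker, Subtype.forall]

theorem smul_mem_truncation [GradedRing 𝒜] {M : GrMod 𝒜} {n : ℤ} {x : M.carrier} {i : ℕ} {a : Λ}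
    (ha : a ∈ 𝒜 i) (hx : x ∈ M.truncation n) : MulOpposite.op a • x ∈ M.truncation (n + i) := by
  rw [mem_truncation] at hx ⊢
  intro k hk
  rw [proj_smul M ha, hx _ (by omega), smul_zero]

/-- Scalars have nonnegative degree, so nothing appears below the degree of the generators. -/
theorem GeneratedInDegree.mem_truncation [GradedRing 𝒜] {M : GrMod 𝒜} {n : ℤ}
    (h : M.GeneratedInDegree n) (x : M.carrier) : x ∈ M.truncation n :=
  h.mem_of_homogeneous (M.truncation n).toAddSubgroup
    (fun _ _ _ _ hx => (M.truncation n).smul_mem _ hx)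
    (fun _ hx => GrMod.mem_truncation.2 fun _ hk => proj_of_mem_ne hx hk.ne') x

theorem GeneratedInDegree.eq_zero_of_mem [GradedRing 𝒜] {M : GrMod 𝒜} {n : ℤ}
    (h : M.GeneratedInDegree n) {k : ℤ} (hk : k < n) {x : M.carrier} (hx : x ∈ M.piece k) :
    x = 0 := by
  rw [← proj_of_mem hx]
  exact GrMod.mem_truncation.1 (h.mem_truncation x) k hk

/-- A semisimple module generated in degree `0` is annihilated by positive degrees. -/
theorem GeneratedInDegree.smul_eq_zero [GradedRing 𝒜] {M : GrMod 𝒜} (hM : M.GeneratedInDegree 0)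
    [IsSemisimpleModule Λᵐᵒᵖ M.carrier] {i : ℕ} (hi : i ≠ 0) {a : Λ} (ha : a ∈ 𝒜 i)
    (m : M.carrier) : MulOpposite.op a • m = 0 := by
  -- `C` need not be graded. Write `m = y + c` with `m` of degree 0, `y` in the truncation and `c ∈
  -- C`. For `a` of degree `i > 0`, `c` times `a` lies in both summands, so it is zero. Thus `m`
  -- times `a` has degree `i`, yet equals `y` times `a`, whose components have degree at least `i +
  -- 1`; it vanishes.
  obtain ⟨C, hC⟩ := exists_isCompl (M.truncation 1)
  have h0 : ∀ m ∈ M.piece 0, ∀ (i : ℕ), i ≠ 0 → ∀ a ∈ 𝒜 i, MulOpposite.op a • m = 0 := by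
    intro m hm i hi a ha
    obtain ⟨y, hy, c, hc, rfl⟩ := Submodule.mem_sup.1 (hC.sup_eq_top ▸ Submodule.mem_top (x := m))
    have hac : MulOpposite.op a • c = 0 := by
      refine (Submodule.disjoint_def.1 hC.disjoint) _ ?_ (C.smul_mem _ hc)
      rw [GrMod.mem_truncation]
      exact fun k hk => GrMod.mem_truncation.1
        (smul_mem_truncation ha (hM.mem_truncation c)) k (by omega)
    have h1 := M.smul_mem i 0 a _ ha hm
    rw [← proj_of_mem h1, smul_add, hac, add_zero]
    exact GrMod.mem_truncation.1 (smul_mem_truncation ha hy) _ (by omega)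
  refine h0 m (hM.mem_of_homogeneous (M.piece 0) (fun j b x hb hx => ?_) le_rfl m) i hi a ha
  rcases eq_or_ne j 0 with rfl | hj
  · simpa using M.smul_mem 0 0 b x hb hx
  · rw [h0 x hx j hj b hb]
    exact AddSubgroup.zero_mem _

/-- A semisimple module generated in degree `0` is concentrated in degree `0`. -/
theorem GeneratedInDegree.mem_piece_zero [GradedRing 𝒜] {M : GrMod 𝒜}
    (hM : M.GeneratedInDegree 0) [IsSemisimpleModule Λᵐᵒᵖ M.carrier] (m : M.carrier) :
    m ∈ M.piece 0 := by
  refine hM.mem_of_homogeneous (M.piece 0) (fun j b x hb hx => ?_) le_rfl m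
  rcases eq_or_ne j 0 with rfl | hj
  · simpa using M.smul_mem 0 0 b x hb hx
  · rw [hM.smul_eq_zero hj hb]
    exact AddSubgroup.zero_mem _

/-- If `N` is annihilated by positive degrees, linear maps from a module generated in degree `n`
to `N` vanish in degrees greater than `n`. -/
theorem GeneratedInDegree.map_eq_zero [GradedRing 𝒜] {X : GrMod 𝒜} {n : ℤ}
    (hX : X.GeneratedInDegree n) {N : Type*} [AddCommGroup N] [Module Λᵐᵒᵖ N]
    (hN : ∀ i : ℕ, i ≠ 0 → ∀ a ∈ 𝒜 i, ∀ y : N, MulOpposite.op a • y = 0)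
    (φ : X.carrier →ₗ[Λᵐᵒᵖ] N) {k : ℤ} (hk : n < k) {x : X.carrier} (hx : x ∈ X.piece k) :
    φ x = 0 := by
  -- The subgroup consists of those `x` all of whose components in degrees above `n` are killed by
  -- `φ`; positive scalars preserve it because they act as zero on `N`.
  have := hX.mem_of_homogeneous
    (⨅ k : {k : ℤ // n < k}, (φ.toAddMonoidHom.comp (X.proj k)).ker) (fun i a x ha hx => ?_) ?_ x
  · simp only [AddSubgroup.mem_iInf, AddMonoidHom.mem_ker, Subtype.forall] at this
    have h := this k hk
    rwa [AddMonoidHom.comp_apply, proj_of_mem hx] at h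
  · simp only [AddSubgroup.mem_iInf, AddMonoidHom.mem_ker, Subtype.forall, AddMonoidHom.comp_apply,
      LinearMap.toAddMonoidHom_coe] at hx ⊢
    intro k hk
    rw [proj_smul X ha, map_smul]
    rcases eq_or_ne i 0 with rfl | hi
    · rw [Nat.cast_zero, sub_zero, hx k hk, smul_zero]
    · exact hN i hi a ha _
  · intro x hx
    simp only [AddSubgroup.mem_iInf, AddMonoidHom.mem_ker, Subtype.forall, AddMonoidHom.comp_apply]
    intro k hk
    rw [proj_of_mem_ne hx hk.ne, map_zero]

theorem GeneratedInDegree.map_lin_eq_zero [GradedRing 𝒜] {X Q : GrMod 𝒜} {m n : ℤ}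
    (hQ : Q.GeneratedInDegree n) (hX : X.GeneratedInDegree m) (hnm : n < m)
    {N : Type*} [AddCommGroup N] [Module Λᵐᵒᵖ N]
    (hN : ∀ i : ℕ, i ≠ 0 → ∀ a ∈ 𝒜 i, ∀ y : N, MulOpposite.op a • y = 0)
    (f : X ⟶ Q) (φ : Q.carrier →ₗ[Λᵐᵒᵖ] N) (x : X.carrier) : φ (lin f x) = 0 := by
  have h : φ ∘ₗ lin f = 0 := LinearMap.ext_on hX fun x hx =>
    hQ.map_eq_zero hN φ hnm (lin_mem f m x hx)
  exact LinearMap.congr_fun h x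

/-! ### Projective covers and syzygies of Koszul modules -/

/-- A lift `f` of `π` through `π'` is onto because `ker π'` is superfluous. Its section `s` is then
onto because `ker π` is superfluous, which forces `f` to be injective. -/
theorem IsProjectiveCover.exists_iso {P P' M : GrMod 𝒜} {π : P ⟶ M} {π' : P' ⟶ M}
    (h : IsProjectiveCover π) (h' : IsProjectiveCover π') : ∃ e : P ≅ P', e.hom ≫ π' = π := by
  have := h.projective
  have := h'.projective
  have := epi_of_surjective h'.surjective
  let f := Projective.factorThru π π'
  have hf : f ≫ π' = π := Projective.factorThru_comp _ _
  have hfs : Function.Surjective (lin f) := by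
    refine LinearMap.range_eq_top.1 (h'.superfluous _ f (eq_top_iff.2 fun y _ => ?_))
    obtain ⟨x, hx⟩ := h.surjective (lin π' y)
    refine Submodule.mem_sup.2 ⟨lin f x, ⟨x, rfl⟩, y - lin f x, ?_, by abel⟩
    rw [LinearMap.mem_ker, map_sub, ← lin_comp_apply, hf, hx, sub_self]
  have := epi_of_surjective hfs
  let s := Projective.factorThru (𝟙 P') f
  have hs : s ≫ f = 𝟙 P' := Projective.factorThru_comp _ _
  have hs' : ∀ y, lin f (lin s y) = y := fun y => LinearMap.congr_fun (congrArg lin hs) y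
  have hss : Function.Surjective (lin s) := by
    refine LinearMap.range_eq_top.1 (h.superfluous _ s (eq_top_iff.2 fun x _ => ?_))
    refine Submodule.mem_sup.2 ⟨lin s (lin f x), ⟨_, rfl⟩, x - lin s (lin f x), ?_, by abel⟩
    rw [LinearMap.mem_ker, map_sub, ← hf, lin_comp_apply, lin_comp_apply, hs', sub_self]
  have hfi : Function.Injective (lin f) := by
    intro x y hxy
    obtain ⟨x, rfl⟩ := hss x
    obtain ⟨y, rfl⟩ := hss y
    rw [hs', hs'] at hxy
    rw [hxy]
  obtain ⟨e, he⟩ := isIso_of_bijective f ⟨hfi, hfs⟩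
  exact ⟨e, by rw [he, hf]⟩

theorem MinimalResolution.isProjectiveCover {M : GrMod 𝒜} (R : MinimalResolution M) :
    IsProjectiveCover R.ε :=
  ⟨R.projective 0, R.surjective, R.minimal_zero⟩

/-- The syzygy given by a minimal resolution. -/
def MinimalResolution.syzygy {M : GrMod 𝒜} (R : MinimalResolution M) : Syzygy M :=
  ⟨ker R.ε, R.P 0, kerι R.ε, R.ε, R.isProjectiveCover, kerι_injective _, kerι_exact _⟩

/-- Transfers the resolution to an arbitrary syzygy: `q` is `d 0` followed by the isomorphism of
covers, with values restricted to `Ω`. Equality of kernels lets the tail of the resolution continue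
from `q`. -/
theorem Syzygy.exists_cover {M : GrMod 𝒜} (hM : isKoszul 𝒜 M) (Z : Syzygy M) :
    Z.P.GeneratedInDegree 0 ∧ ∃ (R : MinimalResolution M)
      (_ : ∀ i : ℕ, (R.P i).GeneratedInDegree i) (q : R.P 1 ⟶ Z.Ω),
      Function.Surjective (lin q) ∧ LinearMap.ker (lin q) = LinearMap.ker (lin (R.d 0)) := by
  obtain ⟨-, R, hR⟩ := hM
  obtain ⟨e, he⟩ := R.isProjectiveCover.exists_iso Z.cover
  have hb := lin_iso_bijective e
  obtain ⟨q, hq⟩ := exists_lift Z.ι Z.injective (R.d 0 ≫ e.hom) fun x => by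
    apply (Z.exact _).1
    rw [← lin_comp_apply, Category.assoc, he]
    exact (R.exact_zero _).2 ⟨x, rfl⟩
  have hq' : ∀ x, lin Z.ι (lin q x) = lin e.hom (lin (R.d 0) x) := fun x =>
    LinearMap.congr_fun (congrArg lin hq) x
  refine ⟨GeneratedInDegree.of_surjective (hR 0) hb.2, R, hR, q, fun y => ?_, ?_⟩
  · obtain ⟨z, hz⟩ := hb.2 (lin Z.ι y)
    have : lin R.ε z = 0 := by
      rw [← he, lin_comp_apply, hz]
      exact (Z.exact _).2 ⟨y, rfl⟩
    obtain ⟨x, rfl⟩ := (R.exact_zero z).1 this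
    exact ⟨x, Z.injective (by rw [hq', hz])⟩
  · ext x
    rw [LinearMap.mem_ker, LinearMap.mem_ker, ← map_eq_zero_iff _ Z.injective, hq',
      map_eq_zero_iff _ hb.1]

theorem Syzygy.generatedInDegree_P {M : GrMod 𝒜} (hM : isKoszul 𝒜 M) (Z : Syzygy M) :
    Z.P.GeneratedInDegree 0 := (Z.exists_cover hM).1

theorem Syzygy.generatedInDegree_Ω {M : GrMod 𝒜} (hM : isKoszul 𝒜 M) (Z : Syzygy M) :
    Z.Ω.GeneratedInDegree 1 := by
  obtain ⟨-, R, hR, q, hq, -⟩ := Z.exists_cover hM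
  exact GeneratedInDegree.of_surjective (by exact_mod_cast hR 1) hq

/-- The resolution of a shifted syzygy obtained by shifting the tail of a minimal resolution. -/
def MinimalResolution.shiftedTail {M N : GrMod 𝒜} (R : MinimalResolution M) (q : R.P 1 ⟶ N)
    (hq : Function.Surjective (lin q)) (hk : LinearMap.ker (lin q) = LinearMap.ker (lin (R.d 0))) :
    MinimalResolution ((shiftFunctor 1).obj N) where
  P i := (shiftFunctor 1).obj (R.P (i + 1))
  d i := (shiftFunctor 1).map (R.d (i + 1))
  ε := (shiftFunctor 1).map q
  projective _ := projective_shift 1 (R.projective _)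
  surjective := hq
  exact_zero x := (SetLike.ext_iff.1 hk x).trans (R.exact_succ 0 x)
  exact_succ i := R.exact_succ (i + 1)
  -- Minimality at `q` is minimality at `d 0`, since the kernels agree.
  minimal_zero := superfluousKernel_shift 1 (superfluousKernel_of_ker_le (R.minimal_succ 0) hk.le)
  minimal_succ _ := superfluousKernel_shift 1 (R.minimal_succ _)

theorem Syzygy.isKoszul_shift {M : GrMod 𝒜} (hM : isKoszul 𝒜 M) (Z : Syzygy M) :
    isKoszul 𝒜 ((shiftFunctor 1).obj Z.Ω) := by
  obtain ⟨-, R, hR, q, hq, hk⟩ := Z.exists_cover hM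
  refine ⟨(Z.generatedInDegree_Ω hM).shift (k := 1) (n := 0), R.shiftedTail q hq hk, fun i => ?_⟩
  have h : (R.P (i + 1)).GeneratedInDegree ((1 : ℤ) + i) := by
    have := hR (i + 1)
    rwa [Nat.cast_add, Nat.cast_one, add_comm (i : ℤ)] at this
  exact h.shift

theorem Syzygy.exists_lift {M N : GrMod 𝒜} (Z : Syzygy M) (Y : Syzygy N) (f : M ⟶ N) :
    ∃ f' : Z.P ⟶ Y.P, f' ≫ Y.π = Z.π ≫ f := by
  have := Z.cover.projective
  have := epi_of_surjective Y.cover.surjective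
  exact ⟨Projective.factorThru (Z.π ≫ f) Y.π, Projective.factorThru_comp _ _⟩

/-- On generators of degree 0, two lifts differ by a degree-0 element of `Y.Ω`, which is zero
because `Y.Ω` is generated in degree 1. -/
theorem Syzygy.lift_unique [GradedRing 𝒜] {M N : GrMod 𝒜} (hM : isKoszul 𝒜 M) (hN : isKoszul 𝒜 N)
    (Z : Syzygy M) (Y : Syzygy N) {f : M ⟶ N} {f' f'' : Z.P ⟶ Y.P}
    (h' : f' ≫ Y.π = Z.π ≫ f) (h'' : f'' ≫ Y.π = Z.π ≫ f) : f' = f'' := by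
  refine (Z.generatedInDegree_P hM).hom_ext fun x hx => sub_eq_zero.1 ?_
  have hmem : lin f' x - lin f'' x ∈ Y.P.piece 0 :=
    AddSubgroup.sub_mem _ (lin_mem f' 0 x hx) (lin_mem f'' 0 x hx)
  have hker : lin Y.π (lin f' x - lin f'' x) = 0 := by
    rw [map_sub, ← lin_comp_apply, ← lin_comp_apply, h', h'', sub_self]
  obtain ⟨y, hy⟩ := (Y.exact _).1 hker
  rw [← hy] at hmem ⊢
  rw [(Y.generatedInDegree_Ω hN).eq_zero_of_mem one_pos (mem_piece_of_lin_mem Y.injective hmem),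
    map_zero]

theorem Syzygy.exists_restriction [GradedRing 𝒜] {M N : GrMod 𝒜} (hM : isKoszul 𝒜 M)
    (hN : isKoszul 𝒜 N) (Z : Syzygy M) (Y : Syzygy N) (f : M ⟶ N) :
    ∃ φ : Z.Ω ⟶ Y.Ω, ∀ f' : Z.P ⟶ Y.P, f' ≫ Y.π = Z.π ≫ f → φ ≫ Y.ι = Z.ι ≫ f' := by
  obtain ⟨g, hg⟩ := Z.exists_lift Y f
  obtain ⟨φ, hφ⟩ := GrMod.exists_lift Y.ι Y.injective (Z.ι ≫ g) fun x => by
    apply (Y.exact _).1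
    rw [← lin_comp_apply, Category.assoc, hg, lin_comp_apply, lin_comp_apply,
      (Z.exact _).2 ⟨x, rfl⟩, map_zero]
  exact ⟨φ, fun f' hf' => by rw [hφ, Z.lift_unique hM hN Y hf' hg]⟩

end GrMod

open GrMod

/-! ### The functor of shifted syzygies: existence, uniqueness, additivity -/

variable {Λ : Type u} [Ring Λ] {𝒜 : ℕ → AddSubgroup Λ}

section

variable [GradedRing 𝒜]

/-- The restriction to syzygies of the lift of a morphism of Koszul modules. -/
def syzygyMap (Z : ∀ M : KoszulMod 𝒜, Syzygy M.obj) {M N : KoszulMod 𝒜} (f : M ⟶ N) :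
    (Z M).Ω ⟶ (Z N).Ω :=
  ((Z M).exists_restriction M.property N.property (Z N) f.hom).choose

theorem syzygyMap_ι (Z : ∀ M : KoszulMod 𝒜, Syzygy M.obj) {M N : KoszulMod 𝒜} (f : M ⟶ N)
    (f' : (Z M).P ⟶ (Z N).P) (h : f' ≫ (Z N).π = (Z M).π ≫ f.hom) :
    syzygyMap Z f ≫ (Z N).ι = (Z M).ι ≫ f' :=
  ((Z M).exists_restriction M.property N.property (Z N) f.hom).choose_spec f' h

/-- The endofunctor `Ω(-)(1)` of the category of Koszul modules. -/
def shiftedSyzygyFunctor (Z : ∀ M : KoszulMod 𝒜, Syzygy M.obj) : KoszulMod 𝒜 ⥤ KoszulMod 𝒜 where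
  obj M := ⟨(shiftFunctor 1).obj (Z M).Ω, (Z M).isKoszul_shift M.property⟩
  map f := ObjectProperty.homMk ((shiftFunctor 1).map (syzygyMap Z f))
  map_id M := by
    have : syzygyMap Z (𝟙 M) = 𝟙 (Z M).Ω := by
      have := mono_of_injective (Z M).injective
      rw [← cancel_mono (Z M).ι, syzygyMap_ι Z (𝟙 M) (𝟙 _) (by simp)]
      simp
    rw [this]
    rfl
  map_comp {M N K} f g := by
    have : syzygyMap Z (f ≫ g) = syzygyMap Z f ≫ syzygyMap Z g := by
      obtain ⟨f', hf⟩ := (Z M).exists_lift (Z N) f.hom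
      obtain ⟨g', hg⟩ := (Z N).exists_lift (Z K) g.hom
      have := mono_of_injective (Z K).injective
      rw [← cancel_mono (Z K).ι, syzygyMap_ι Z (f ≫ g) (f' ≫ g') (by simp [hg, reassoc_of% hf]),
        Category.assoc, syzygyMap_ι Z g g' hg, reassoc_of% (syzygyMap_ι Z f f' hf)]
    rw [this]
    rfl

theorem isShiftedSyzygyFunctor_shiftedSyzygyFunctor (Z : ∀ M : KoszulMod 𝒜, Syzygy M.obj) :
    IsShiftedSyzygyFunctor Z (shiftedSyzygyFunctor Z) := by
  refine ⟨fun M => rfl, fun M N f f' h => ?_⟩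
  have := congrArg (shiftFunctor 1).map (syzygyMap_ι Z f f' h)
  -- The object equalities hold by `rfl`, so each `eqToHom` is an identity.
  exact (congrArg (_ ≫ ·) (Category.id_comp _)).trans (this.trans (Category.id_comp _).symm)

end

/-- The inclusion `F M → P_M(1)` for a functor `F` with `F M = Ω M(1)`. -/
def shiftedInclusion {Z : ∀ M : KoszulMod 𝒜, Syzygy M.obj} {F : KoszulMod 𝒜 ⥤ KoszulMod 𝒜}
    (h : ∀ M : KoszulMod 𝒜, (F.obj M).obj = (shiftFunctor 1).obj (Z M).Ω) (M : KoszulMod 𝒜) :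
    (F.obj M).obj ⟶ (shiftFunctor 1).obj (Z M).P :=
  eqToHom (h M) ≫ (shiftFunctor 1).map (Z M).ι

theorem shiftedInclusion_injective {Z : ∀ M : KoszulMod 𝒜, Syzygy M.obj}
    {F : KoszulMod 𝒜 ⥤ KoszulMod 𝒜}
    (h : ∀ M : KoszulMod 𝒜, (F.obj M).obj = (shiftFunctor 1).obj (Z M).Ω) (M : KoszulMod 𝒜) :
    Function.Injective (lin (shiftedInclusion h M)) :=
  (Z M).injective.comp (lin_iso_bijective (eqToIso (h M))).1

theorem shiftedInclusion_exact {Z : ∀ M : KoszulMod 𝒜, Syzygy M.obj}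
    {F : KoszulMod 𝒜 ⥤ KoszulMod 𝒜}
    (h : ∀ M : KoszulMod 𝒜, (F.obj M).obj = (shiftFunctor 1).obj (Z M).Ω) (M : KoszulMod 𝒜) :
    Function.Exact (lin (shiftedInclusion h M)) (lin ((shiftFunctor 1).map (Z M).π)) := by
  intro x
  refine ((Z M).exact x).trans ⟨?_, ?_⟩
  · rintro ⟨y, rfl⟩
    obtain ⟨z, rfl⟩ := (lin_iso_bijective (eqToIso (h M))).2 y
    exact ⟨z, rfl⟩
  · rintro ⟨z, rfl⟩
    exact ⟨_, rfl⟩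

/-- A lift of `f` exists and the inclusion into `P_N(1)` is mono, so the square determines the value
at `f`; the rest is transport along object equalities. -/
theorem IsShiftedSyzygyFunctor.eq {Z : ∀ M : KoszulMod 𝒜, Syzygy M.obj}
    {F G : KoszulMod 𝒜 ⥤ KoszulMod 𝒜} (hF : IsShiftedSyzygyFunctor Z F)
    (hG : IsShiftedSyzygyFunctor Z G) : F = G := by
  obtain ⟨hF, hF'⟩ := hF
  obtain ⟨hG, hG'⟩ := hG
  have hobj : ∀ M, F.obj M = G.obj M := fun M =>
    ObjectProperty.FullSubcategory.ext ((hF M).trans (hG M).symm)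
  have hom_eqToHom : ∀ {A B : KoszulMod 𝒜} (e : A = B),
      (eqToHom e).hom = eqToHom (congrArg ObjectProperty.FullSubcategory.obj e) := by
    rintro A _ rfl; rfl
  refine CategoryTheory.Functor.ext hobj fun M N f => ObjectProperty.hom_ext _ ?_
  obtain ⟨f', hf'⟩ := (Z M).exists_lift (Z N) f.hom
  have := mono_of_injective (shiftedInclusion_injective hF N)
  rw [← cancel_mono (shiftedInclusion hF N)]
  have h1 := hF' M N f f' hf'
  have h2 := hG' M N f f' hf'
  simp only [ObjectProperty.FullSubcategory.comp_hom, hom_eqToHom, shiftedInclusion,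
    Category.assoc, eqToHom_trans_assoc] at h1 h2 ⊢
  rw [h1, h2, eqToHom_trans_assoc]

theorem IsShiftedSyzygyFunctor.additive {Z : ∀ M : KoszulMod 𝒜, Syzygy M.obj}
    {F : KoszulMod 𝒜 ⥤ KoszulMod 𝒜} (hF : IsShiftedSyzygyFunctor Z F) : F.Additive where
  map_add {M N f g} := by
    obtain ⟨h, hF⟩ := hF
    obtain ⟨f', hf⟩ := (Z M).exists_lift (Z N) f.hom
    obtain ⟨g', hg⟩ := (Z M).exists_lift (Z N) g.hom
    have := mono_of_injective (shiftedInclusion_injective h N)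
    refine ObjectProperty.hom_ext _ ?_
    rw [← cancel_mono (shiftedInclusion h N)]
    have hfg : (f' + g') ≫ (Z N).π = (Z M).π ≫ (f + g).hom := by
      rw [Preadditive.add_comp, hf, hg, ← Preadditive.comp_add]; rfl
    refine (hF M N (f + g) (f' + g') hfg).trans ?_
    have h1 := hF M N f f' hf
    have h2 := hF M N g g' hg
    have h3 : ((F.map f + F.map g : F.obj M ⟶ F.obj N)).hom = (F.map f).hom + (F.map g).hom := rfl
    have h4 : (shiftFunctor 1).map (f' + g') =
      (shiftFunctor 1).map f' + (shiftFunctor 1).map g' := rfl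
    rw [h3, h4, Preadditive.add_comp, Preadditive.comp_add, Preadditive.comp_add]
    exact (congrArg₂ (· + ·) h1 h2).symm

/-! ### Orbital rings and Yoneda algebras -/

section Orbital

open Abelian

universe v' u'

variable {K : Type u} [Category.{v} K] {C : Type u'} [Category.{v'} C] [Abelian C] [HasExt.{w} C]
  {F : K ⥤ K} {U : K ⥤ C}

/-- The class in `Extⁿ(U X, U (Fⁿ X))` obtained by splicing classes `δ X ∈ Ext¹(U X, U (F X))`. -/
def splice (δ : ∀ X : K, Ext.{w} (U.obj X) (U.obj (F.obj X)) 1) :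
    ∀ (n : ℕ) (X : K), Ext.{w} (U.obj X) (U.obj ((iterFunctor F n).obj X)) n
  | 0, X => Ext.mk₀ (𝟙 (U.obj X))
  | n + 1, X => (δ X).comp (splice δ n (F.obj X)) (add_comm 1 n)

theorem splice_naturality {δ : ∀ X : K, Ext.{w} (U.obj X) (U.obj (F.obj X)) 1}
    (hδ : ∀ {X Y : K} (f : X ⟶ Y), (δ X).comp (Ext.mk₀ (U.map (F.map f))) (add_zero 1) =
      (Ext.mk₀ (U.map f)).comp (δ Y) (zero_add 1)) (n : ℕ) {X Y : K} (f : X ⟶ Y) :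
    (splice δ n X).comp (Ext.mk₀ (U.map ((iterFunctor F n).map f))) (add_zero n) =
      (Ext.mk₀ (U.map f)).comp (splice δ n Y) (zero_add n) := by
  induction n generalizing X Y with
  | zero =>
    change (Ext.mk₀ (𝟙 (U.obj X))).comp (Ext.mk₀ (U.map f)) _ =
      (Ext.mk₀ (U.map f)).comp (Ext.mk₀ (𝟙 (U.obj Y))) _
    simp
  | succ n ih =>
    refine (Ext.comp_assoc_of_third_deg_zero (δ X) (splice δ n (F.obj X)) _ _).trans ?_
    refine (congrArg (fun t => (δ X).comp t (add_comm 1 n)) (ih (F.map f))).trans ?_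
    rw [← Ext.comp_assoc_of_second_deg_zero, hδ]
    exact Ext.comp_assoc _ (δ Y) (splice δ n (F.obj Y)) _ _ (by omega)

/-- Induction on `j`, since `δ X` is split off at the source. The identification of `Fⁱ⁺ʲ⁺¹ X` with
`Fⁱ (Fʲ⁺¹ X)` is by definition the one of `j` at `F X`. -/
theorem splice_add (δ : ∀ X : K, Ext.{w} (U.obj X) (U.obj (F.obj X)) 1) (i j : ℕ) (X : K) :
    (splice δ (i + j) X).comp (Ext.mk₀ (U.map (eqToHom
      (congrArg (fun G : K ⥤ K => G.obj X) (iterFunctor_add F i j))))) (add_zero (i + j)) =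
      (splice δ j X).comp (splice δ i ((iterFunctor F j).obj X)) (add_comm j i) := by
  induction j generalizing X with
  | zero =>
    change (splice δ i X).comp (Ext.mk₀ (U.map (𝟙 _))) _ =
      (Ext.mk₀ (𝟙 (U.obj X))).comp (splice δ i X) _
    simp
  | succ j ih =>
    refine (Ext.comp_assoc_of_third_deg_zero (δ X) (splice δ (i + j) (F.obj X)) _ _).trans ?_
    refine (congrArg (fun t => (δ X).comp t (add_comm 1 (i + j))) (ih (F.obj X))).trans ?_
    exact (Ext.comp_assoc (δ X) (splice δ j (F.obj X)) _ _ _ (by omega)).symm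

/-- The map `Hom(Fⁿ X, M) → Extⁿ(U X, U M)` given by composition with the spliced class. -/
def orbitalToExt [Preadditive K] [U.Additive]
    (δ : ∀ X : K, Ext.{w} (U.obj X) (U.obj (F.obj X)) 1) (n : ℕ) (X M : K) :
    ((iterFunctor F n).obj X ⟶ M) →+ Ext.{w} (U.obj X) (U.obj M) n where
  toFun f := (splice δ n X).comp (Ext.mk₀ (U.map f)) (add_zero n)
  map_zero' := by simp
  map_add' f g := by simp [Ext.mk₀_add]

variable [Preadditive K] [U.Additive]

/-- Dimension shifting: each step replaces `X` by `F X` and lowers the degree by one, down to `Hom`.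
-/
theorem orbitalToExt_bijective (δ : ∀ X : K, Ext.{w} (U.obj X) (U.obj (F.obj X)) 1) (M : K)
    (hU : ∀ X : K, Function.Bijective (U.map : (X ⟶ M) → (U.obj X ⟶ U.obj M)))
    (hδ : ∀ (X : K) (n : ℕ), Function.Bijective fun α : Ext.{w} (U.obj (F.obj X)) (U.obj M) n =>
      (δ X).comp α (add_comm 1 n)) (n : ℕ) (X : K) :
    Function.Bijective (orbitalToExt δ n X M) := by
  induction n generalizing X with
  | zero =>
    have : (orbitalToExt δ 0 X M : (X ⟶ M) → Ext.{w} (U.obj X) (U.obj M) 0) =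
        Ext.mk₀ ∘ U.map := funext fun f => Ext.mk₀_id_comp _
    exact this ▸ (Ext.mk₀_bijective _ _).comp (hU X)
  | succ n ih =>
    have : (orbitalToExt δ (n + 1) X M :
        ((iterFunctor F n).obj (F.obj X) ⟶ M) → Ext.{w} (U.obj X) (U.obj M) (n + 1)) =
        (fun α => (δ X).comp α (add_comm 1 n)) ∘ orbitalToExt δ n (F.obj X) M :=
      funext fun f => Ext.comp_assoc_of_third_deg_zero _ _ _ _
    exact this ▸ (hδ X n).comp (ih (F.obj X))

theorem orbitalToExt_comp (δ : ∀ X : K, Ext.{w} (U.obj X) (U.obj (F.obj X)) 1)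
    (hδ : ∀ {X Y : K} (f : X ⟶ Y), (δ X).comp (Ext.mk₀ (U.map (F.map f))) (add_zero 1) =
      (Ext.mk₀ (U.map f)).comp (δ Y) (zero_add 1)) {M : K} {i j : ℕ}
    (f : (iterFunctor F i).obj M ⟶ M) (g : (iterFunctor F j).obj M ⟶ M) :
    orbitalToExt δ (i + j) M M (orbitalMul F M f g) =
      (orbitalToExt δ j M M g).comp (orbitalToExt δ i M M f) (add_comm j i) := by
  change (splice δ (i + j) M).comp (Ext.mk₀ (U.map
      (eqToHom _ ≫ (iterFunctor F i).map g ≫ f))) (add_zero (i + j)) =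
    ((splice δ j M).comp (Ext.mk₀ (U.map g)) (add_zero j)).comp
      ((splice δ i M).comp (Ext.mk₀ (U.map f)) (add_zero i)) (add_comm j i)
  rw [U.map_comp, U.map_comp, ← Ext.mk₀_comp_mk₀, ← Ext.mk₀_comp_mk₀,
    ← Ext.comp_assoc_of_second_deg_zero]
  refine (congrArg (fun t => Ext.comp t _ (add_zero (i + j))) (splice_add δ i j M)).trans ?_
  rw [Ext.comp_assoc_of_third_deg_zero, Ext.comp_assoc_of_second_deg_zero,
    -- Naturality moves `Fⁱ(g)` across the `i`-fold splice, where it becomes `g`.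
    ← Ext.comp_assoc_of_second_deg_zero (splice δ i _), splice_naturality hδ,
    Ext.comp_assoc_of_third_deg_zero]

/-- Natural classes `δ X ∈ Ext¹(U X, U (F X))` such that composition with `δ X` is an isomorphism
`Extⁿ(U (F X), U M) ≅ Extⁿ⁺¹(U X, U M)` identify the orbital ring with the Yoneda algebra. -/
theorem gradedRingIsomorphic_orbital_yoneda [F.Additive]
    (δ : ∀ X : K, Ext.{w} (U.obj X) (U.obj (F.obj X)) 1)
    (hδ : ∀ {X Y : K} (f : X ⟶ Y), (δ X).comp (Ext.mk₀ (U.map (F.map f))) (add_zero 1) =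
      (Ext.mk₀ (U.map f)).comp (δ Y) (zero_add 1)) (M : K)
    (hU : ∀ X : K, Function.Bijective (U.map : (X ⟶ M) → (U.obj X ⟶ U.obj M)))
    (hδ' : ∀ (X : K) (n : ℕ), Function.Bijective fun α : Ext.{w} (U.obj (F.obj X)) (U.obj M) n =>
      (δ X).comp α (add_comm 1 n)) :
    GradedRingIsomorphic (OrbitalPiece F M) (YonedaPiece.{w} (U.obj M)) := by
  let θ (i : ℕ) : OrbitalPiece F M i →+ YonedaPiece.{w} (U.obj M) i := orbitalToExt δ i M M
  have hθ : ∀ i, Function.Bijective (θ i) := fun i => orbitalToExt_bijective δ M hU hδ' i M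
  have hone : θ 0 GradedMonoid.GOne.one = GradedMonoid.GOne.one := by
    change (Ext.mk₀ (𝟙 (U.obj M))).comp (Ext.mk₀ (U.map (𝟙 M))) (add_zero 0) =
      Ext.mk₀ (𝟙 (U.obj M))
    simp
  have hmul : ∀ {i j : ℕ} (f : OrbitalPiece F M i) (g : OrbitalPiece F M j),
      θ (i + j) (GradedMonoid.GMul.mul f g) = GradedMonoid.GMul.mul (θ i f) (θ j g) := by
    intro i j f g
    exact orbitalToExt_comp δ hδ f g
  let Θ : (⨁ i, OrbitalPiece F M i) →+* ⨁ i, YonedaPiece.{w} (U.obj M) i :=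
    DirectSum.toSemiring (fun i => (of (YonedaPiece.{w} (U.obj M)) i).comp (θ i))
      (by rw [AddMonoidHom.comp_apply, hone]; rfl)
      (fun {i j} f g => by
        rw [AddMonoidHom.comp_apply, hmul, AddMonoidHom.comp_apply, AddMonoidHom.comp_apply,
          DirectSum.of_mul_of])
  have hΘ : ∀ i f, Θ (of _ i f) = of _ i (θ i f) := fun i f => DirectSum.toSemiring_of _ _ _ i f
  have hmap : (Θ : (⨁ i, OrbitalPiece F M i) →+ ⨁ i, YonedaPiece.{w} (U.obj M) i) =
      DirectSum.map θ := DirectSum.addHom_ext fun i f =>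
        (hΘ i f).trans (DirectSum.map_of θ i f).symm
  have hbij : Function.Bijective Θ := by
    change Function.Bijective
      (Θ : (⨁ i, OrbitalPiece F M i) →+ ⨁ i, YonedaPiece.{w} (U.obj M) i)
    rw [hmap]
    exact ⟨(DirectSum.map_injective θ).2 fun i => (hθ i).1,
      (DirectSum.map_surjective θ).2 fun i => (hθ i).2⟩
  exact ⟨RingEquiv.ofBijective Θ hbij, fun i f => ⟨θ i f, hΘ i f⟩⟩

end Orbital

/-! ### The comparison for Koszul modules -/

/-- The functor that forgets the grading of a Koszul module. -/
def forgetGrading (𝒜 : ℕ → AddSubgroup Λ) : KoszulMod 𝒜 ⥤ ModuleCat.{u} Λᵐᵒᵖ where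
  obj M := ModuleCat.of Λᵐᵒᵖ M.obj.carrier
  map f := ModuleCat.ofHom (lin f.hom)

instance : (forgetGrading 𝒜).Additive where

section

variable {Z : ∀ M : KoszulMod 𝒜, Syzygy M.obj} {F : KoszulMod 𝒜 ⥤ KoszulMod 𝒜}
  (h : ∀ M : KoszulMod 𝒜, (F.obj M).obj = (shiftFunctor 1).obj (Z M).Ω)

/-- The sequence `0 → F M → P_M → M → 0` of ungraded modules. -/
def syzygySequence (M : KoszulMod 𝒜) : ShortComplex (ModuleCat.{u} Λᵐᵒᵖ) :=
  ShortComplex.mk (X₁ := (forgetGrading 𝒜).obj (F.obj M))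
    (X₂ := ModuleCat.of Λᵐᵒᵖ ((shiftFunctor 1).obj (Z M).P).carrier)
    (X₃ := (forgetGrading 𝒜).obj M)
    (ModuleCat.ofHom (lin (shiftedInclusion h M)))
    (ModuleCat.ofHom (show (Z M).P.carrier →ₗ[Λᵐᵒᵖ] M.obj.carrier from lin (Z M).π))
    (ModuleCat.hom_ext (LinearMap.ext fun x => (shiftedInclusion_exact h M _).2 ⟨x, rfl⟩))

theorem syzygySequence_shortExact (M : KoszulMod 𝒜) : (syzygySequence h M).ShortExact where
  exact := (ShortComplex.ShortExact.moduleCat_exact_iff_function_exact _).2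
    (shiftedInclusion_exact h M)
  mono_f := (ModuleCat.mono_iff_injective _).2 (shiftedInclusion_injective h M)
  epi_g := (ModuleCat.epi_iff_surjective _).2 (Z M).cover.surjective

/-- A lift `f'` completes `F f` and `f` to a morphism of short exact sequences. -/
theorem syzygySequence_extClass_naturality
    (hF : ∀ (M N : KoszulMod 𝒜) (f : M ⟶ N) (f' : (Z M).P ⟶ (Z N).P),
      f' ≫ (Z N).π = (Z M).π ≫ f.hom →
        (F.map f).hom ≫ shiftedInclusion h N = shiftedInclusion h M ≫ (shiftFunctor 1).map f')
    {M N : KoszulMod 𝒜} (f : M ⟶ N) :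
    (syzygySequence_shortExact h M).extClass.comp
        (Abelian.Ext.mk₀ ((forgetGrading 𝒜).map (F.map f))) (add_zero 1) =
      (Abelian.Ext.mk₀ ((forgetGrading 𝒜).map f)).comp
        (syzygySequence_shortExact h N).extClass (zero_add 1) := by
  obtain ⟨f', hf⟩ := (Z M).exists_lift (Z N) f.hom
  let φ : syzygySequence h M ⟶ syzygySequence h N :=
    { τ₁ := (forgetGrading 𝒜).map (F.map f)
      τ₂ := ModuleCat.ofHom (lin ((shiftFunctor 1).map f'))
      τ₃ := (forgetGrading 𝒜).map f
      comm₁₂ := ModuleCat.hom_ext (congrArg lin (hF M N f f' hf))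
      comm₂₃ := ModuleCat.hom_ext (congrArg lin hf) }
  exact ShortComplex.ShortExact.extClass_naturality (syzygySequence_shortExact h M)
    (syzygySequence_shortExact h N) φ

theorem syzygySequence_projective [GradedRing 𝒜] (M : KoszulMod 𝒜) :
    Projective (syzygySequence h M).X₂ :=
  (IsProjective.iff_projective _).1 (module_projective _ (projective_shift 1 (Z M).cover.projective))

theorem syzygySequence_extClass_comp_bijective [GradedRing 𝒜] {M : KoszulMod 𝒜}
    (hM : IsSemisimpleModule Λᵐᵒᵖ M.obj.carrier) (X : KoszulMod 𝒜) (n : ℕ) :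
    Function.Bijective fun α : Abelian.Ext.{u} (syzygySequence h X).X₁ ((forgetGrading 𝒜).obj M) n =>
      (syzygySequence_shortExact h X).extClass.comp α (add_comm 1 n) := by
  have hP := syzygySequence_projective h X
  -- After the shift, `P_X(1)` is generated in degree -1 and `F X` in degree 0; this gap kills the
  -- maps restricted from `P_X` when `n = 0`.
  have hXP : ((shiftFunctor 1).obj (Z X).P).GeneratedInDegree (-1) :=
    (show (Z X).P.GeneratedInDegree (1 + -1) from (Z X).generatedInDegree_P X.property).shift
  constructor
  · intro α β hαβ
    rw [← sub_eq_zero]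
    have h0 : (syzygySequence_shortExact h X).extClass.comp (α - β) (add_comm 1 n) = 0 := by
      rw [sub_eq_add_neg, Abelian.Ext.comp_add, Abelian.Ext.comp_neg]
      exact sub_eq_zero_of_eq hαβ |> (sub_eq_add_neg _ _).symm.trans
    -- A class killed by `δ X` is restricted from `P_X`: such restrictions vanish by degrees if `n =
    -- 0`, by projectivity if `n > 0`.
    obtain ⟨γ, hγ⟩ := Abelian.Ext.contravariant_sequence_exact₁ _ _ _ _ h0
    rw [← hγ]
    rcases n with _ | n
    · obtain ⟨φ, rfl⟩ := (Abelian.Ext.mk₀_bijective _ _).2 γ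
      rw [Abelian.Ext.mk₀_comp_mk₀]
      have : (syzygySequence h X).f ≫ φ = 0 := by
        refine ModuleCat.hom_ext (LinearMap.ext fun x => ?_)
        exact GeneratedInDegree.map_lin_eq_zero (X := (F.obj X).obj) hXP (F.obj X).property.1
          neg_one_lt_zero (fun i hi a ha y => M.property.1.smul_eq_zero hi ha y)
          (shiftedInclusion h X) φ.hom x
      rw [this, Abelian.Ext.mk₀_zero]
    · rw [Abelian.Ext.eq_zero_of_projective γ, Abelian.Ext.comp_zero]
  · intro β
    exact Abelian.Ext.contravariant_sequence_exact₃ _ _ β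
      (Abelian.Ext.eq_zero_of_projective _) (add_comm 1 n)

end

theorem forgetGrading_map_bijective [GradedRing 𝒜] {M : KoszulMod 𝒜}
    (hM : IsSemisimpleModule Λᵐᵒᵖ M.obj.carrier) (X : KoszulMod 𝒜) :
    Function.Bijective ((forgetGrading 𝒜).map :
      (X ⟶ M) → ((forgetGrading 𝒜).obj X ⟶ (forgetGrading 𝒜).obj M)) := by
  constructor
  · intro f g hfg
    exact ObjectProperty.hom_ext _ (lin_injective (congrArg ModuleCat.Hom.hom hfg))
  · intro φ
    let ψ : X.obj.carrier →ₗ[Λᵐᵒᵖ] M.obj.carrier := φ.hom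
    refine ⟨ObjectProperty.homMk (⟨ψ, fun n x hx => ?_⟩ : Hom X.obj M.obj), rfl⟩
    -- `X` is zero below degree 0, `M` lies entirely in degree 0, and `ψ` vanishes on `X` above
    -- degree 0.
    rcases lt_trichotomy n 0 with hn | rfl | hn
    · rw [X.property.1.eq_zero_of_mem hn hx, map_zero]
      exact AddSubgroup.zero_mem _
    · exact M.property.1.mem_piece_zero _
    · rw [X.property.1.map_eq_zero (fun i hi a ha y => M.property.1.smul_eq_zero hi ha y) ψ hn hx]
      exact AddSubgroup.zero_mem _

end

theorem proposition3p6 {Λ : Type u} [Ring Λ] (𝒜 : ℕ → AddSubgroup Λ) [GradedRing 𝒜]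
    [IsSemisimpleRing (𝒜 0)] :
    (∀ M : KoszulMod 𝒜, Nonempty (GrMod.Syzygy M.obj)) ∧
    ∀ Z : ∀ M : KoszulMod 𝒜, GrMod.Syzygy M.obj,
      (∃! F : KoszulMod 𝒜 ⥤ KoszulMod 𝒜, IsShiftedSyzygyFunctor Z F) ∧
      ∀ F : KoszulMod 𝒜 ⥤ KoszulMod 𝒜, IsShiftedSyzygyFunctor Z F →
        ∃ _ : F.Additive,
          ∀ M : KoszulMod 𝒜, Module.Finite Λᵐᵒᵖ M.obj.carrier →
            IsSemisimpleModule Λᵐᵒᵖ M.obj.carrier →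
              GradedRingIsomorphic (OrbitalPiece F M)
                (YonedaPiece (ModuleCat.of Λᵐᵒᵖ M.obj.carrier)) := by
  refine ⟨fun M => ?_, fun Z => ⟨⟨shiftedSyzygyFunctor Z,
    isShiftedSyzygyFunctor_shiftedSyzygyFunctor Z, fun G hG =>
      hG.eq (isShiftedSyzygyFunctor_shiftedSyzygyFunctor Z)⟩, fun F hF => ⟨hF.additive,
    fun M _ hM => ?_⟩⟩⟩
  · obtain ⟨-, R, -⟩ := M.property
    exact ⟨R.syzygy⟩
  · have := hF.additive
    obtain ⟨h, hF⟩ := hF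
    exact gradedRingIsomorphic_orbital_yoneda (U := forgetGrading 𝒜)
      (fun X => (syzygySequence_shortExact h X).extClass)
      -- `hF` fits because composition of graded morphisms is associative by definition.
      (syzygySequence_extClass_naturality h hF) M (forgetGrading_map_bijective hM)
      (syzygySequence_extClass_comp_bijective h hM)
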